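/- For $n\ge 1$ let $[n]=\{1,\dots,n\}$, let $B_n$ be the Bell number (the number of set partitions of an $n$-element set, $B_0=1$), and let $S_{n,k}$ be the Stirling number of the second kind (the number of partitions of an $n$-element set into exactly $k$ nonempty blocks; $S_{n,k}=0$ if $k<0$). Two blocks $B,B'$ of a partition of $[n]$ are said to \emph{embrace} if, for one of the two orderings of the pair, $\min B<\min B'\le\max B'<\max B$. Let $\mathrm{emb}(\pi)$ be the number of pairs of blocks of $\pi$ that embrace. Let $\mu_n$ be the average of $\mathrm{emb}(\pi)$ over all partitions $\pi$ of $[n]$, and for $1\le k\le n$ let $\mu_{n,k}$ be its average over all partitions of $[n]$ into exactly $k$ blocks. (1) For every $n\ge1$, $$\mu_n=\frac14\frac{B_{n+2}}{B_n}-\frac54\frac{B_{n+1}}{B_n}+\frac34+\frac n2\frac{B_{n-1}}{B_n},$$ and, as $n\to\infty$, $$\mu_n=\frac14\left(\frac n{\log n}\right)^2\left(1+2\,\frac{\log\log n}{\log n}\,(1+o(1))\right).$$ (2) For all $n\ge k\ge1$, $$\mu_{n,k}=\frac12\binom k2-\frac12(k-1)\frac{S_{n,k-1}}{S_{n,k}}+\frac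 n2\frac{S_{n-1,k-2}}{S_{n,k}},$$ and, for every fixed $k\ge1$, $\mu_{n,k}=\frac12\binom k2+o(1)$ as $n\to\infty$. -/

import Mathlib

open Filter Topology

/-- Two finite sets `B`, `B'` of integers embrace (with `B` the outer one) if they are nonempty and
`min B < min B' ≤ max B' < max B`. -/
def Embrace (B B' : Finset ℕ) : Prop :=
  ∃ (h : B.Nonempty) (h' : B'.Nonempty),
    B.min' h < B'.min' h' ∧ B'.min' h' ≤ B'.max' h' ∧ B'.max' h' < B.max' h

open Classical in
/-- The number of embracings of a set partition: the number of pairs `(B, B')` of blocks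
such that `B` embraces `B'`.  (The relation is asymmetric, so every embracing pair of
blocks is counted exactly once.) -/
noncomputable def emb {S : Finset ℕ} (π : Finpartition S) : ℕ :=
  ((π.parts ×ˢ π.parts).filter fun p => Embrace p.1 p.2).card

/-- The finite set of all partitions of `[n] = {1, …, n}`. -/
def setPartitions (n : ℕ) : Finset (Finpartition (Finset.Icc 1 n)) :=
  Finset.univ

/-- The finite set of all partitions of `[n] = {1, …, n}` into exactly `k` blocks. -/
def setPartitionsInto (n k : ℕ) : Finset (Finpartition (Finset.Icc 1 n)) :=
  Finset.univ.filter fun π => π.parts.card = k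

/-- The average number of embracings in a uniformly random partition of `[n]`. -/
noncomputable def meanEmb (n : ℕ) : ℝ :=
  (∑ π ∈ setPartitions n, (emb π : ℝ)) / (setPartitions n).card

/-- The average number of embracings in a uniformly random partition of `[n]` into `k` blocks. -/
noncomputable def meanEmbInto (n k : ℕ) : ℝ :=
  (∑ π ∈ setPartitionsInto n k, (emb π : ℝ)) / (setPartitionsInto n k).card

/-- The Stirling number of the second kind `S_{n,k}` for an integer `k`, with the usual
convention that it is `0` when `k < 0` (no partition has a negative number of blocks). -/
def stirlingS (n : ℕ) : ℤ → ℕ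
  | Int.ofNat k => Nat.stirlingSecond n k
  | Int.negSucc _ => 0

/-! Partitions are built by inserting a new maximum `a`. As a singleton block, `a` changes no
embracing. Put into a block `B`, it makes `B` embrace exactly the blocks of larger minimum and be
embraced by none, while pairs avoiding `B` are untouched. Summing over the `k` choices of `B` gives
`(k - 2) * emb + k.choose 2` (`sum_embPairs_addTo`), hence a linear recurrence in `n` and `k` for
the total number of embracings (`embCount_insert`). Its solution in Stirling numbers is
`embCount_eq`; summing over `k` turns it into Bell numbers.

For fixed `k`, the Stirling quotients decay geometrically, since `S_{n,k}` is `k ^ n` up to constant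
factors. For the mean over all partitions, everything rests on `R_n = B_{n+1} / B_n`. Dobinski's
series makes `R_n` nondecreasing, and the binomial recurrence then gives `R_n ≥ (1 + 1/R_n) ^ n`;
the decay of the Dobinski weights beyond their peak gives a matching upper bound
(`bellRatio_le_of_le`). Both say roughly `R_n log R_n = n`, so `R_n = (n / log n)(1 + (1 + o(1)) log
log n / log n)`. The leading term of the mean is `R_n R_{n+1} / 4`. -/

/-! ### Set partitions as sets of blocks, and insertion of an element -/

/-- The set of all partitions of `S`, each given as its set of blocks. -/
def partsOf (S : Finset ℕ) : Finset (Finset (Finset ℕ)) :=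
  (Finset.univ : Finset (Finpartition S)).image Finpartition.parts

theorem mem_partsOf {S : Finset ℕ} {P : Finset (Finset ℕ)} :
    P ∈ partsOf S ↔ ∅ ∉ P ∧ (∀ B ∈ P, ∀ C ∈ P, ∀ x, x ∈ B → x ∈ C → B = C) ∧
      ∀ x, x ∈ S ↔ ∃ B ∈ P, x ∈ B := by
  simp only [partsOf, Finset.mem_image, Finset.mem_univ, true_and]
  constructor
  · rintro ⟨π, rfl⟩
    refine ⟨π.bot_notMem, fun B hB C hC x hx hx' => π.eq_of_mem_parts hB hC hx hx', fun x => ?_⟩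
    conv_lhs => rw [← π.biUnion_parts]
    simp
  · rintro ⟨h0, h1, h2⟩
    refine ⟨⟨P, ?_, ?_, h0⟩, rfl⟩
    · rw [Finset.supIndep_iff_pairwiseDisjoint]
      intro B hB C hC hne
      exact Finset.disjoint_left.2 fun x hx hx' => hne (h1 B hB C hC x hx hx')
    · ext x
      rw [h2 x, Finset.mem_sup]
      rfl

theorem sum_finpartition_eq_sum_partsOf {S : Finset ℕ} {M : Type*} [AddCommMonoid M]
    (f : Finset (Finset ℕ) → M) :
    ∑ π : Finpartition S, f π.parts = ∑ P ∈ partsOf S, f P := by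
  rw [partsOf, Finset.sum_image]
  intro π _ π' _ h
  exact Finpartition.ext h

/-- Put `a` into the block `B` of `P`; for `B = ∅` this adds the block `{a}`. -/
def addTo (a : ℕ) (P : Finset (Finset ℕ)) (B : Finset ℕ) : Finset (Finset ℕ) :=
  insert (insert a B) (P.erase B)

theorem addTo_mem_partsOf {S : Finset ℕ} {a : ℕ} (ha : a ∉ S) {P : Finset (Finset ℕ)}
    (hP : P ∈ partsOf S) {B : Finset ℕ} (hB : B ∈ insert ∅ P) :
    addTo a P B ∈ partsOf (insert a S) := by
  rw [mem_partsOf] at hP ⊢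
  obtain ⟨h0, h1, h2⟩ := hP
  have hall : ∀ C ∈ P, a ∉ C := fun C hC haC => ha ((h2 a).2 ⟨C, hC, haC⟩)
  have key : ∀ C ∈ P, C ≠ B → ∀ x ∈ B, x ∉ C := by
    intro C hC hne x hx hxC
    rcases Finset.mem_insert.1 hB with rfl | hB
    · simp at hx
    · exact hne (h1 C hC B hB x hxC hx)
  simp only [addTo, Finset.mem_insert, Finset.mem_erase]
  refine ⟨?_, ?_, ?_⟩
  · rintro (h | h)
    · exact Finset.insert_ne_empty _ _ h.symm
    · exact h0 h.2
  · rintro C (rfl | ⟨hC, hCP⟩) D (rfl | ⟨hD, hDP⟩) x hxC hxD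
    · rfl
    · rcases Finset.mem_insert.1 hxC with rfl | hx
      · exact absurd hxD (hall D hDP)
      · exact absurd hxD (key D hDP hD x hx)
    · rcases Finset.mem_insert.1 hxD with rfl | hx
      · exact absurd hxC (hall C hCP)
      · exact absurd hxC (key C hCP hC x hx)
    · exact h1 C hCP D hDP x hxC hxD
  · intro x
    constructor
    · rintro (rfl | hx)
      · exact ⟨_, Or.inl rfl, Finset.mem_insert_self _ _⟩
      · obtain ⟨C, hC, hxC⟩ := (h2 x).1 hx
        by_cases hCB : C = B
        · exact ⟨_, Or.inl rfl, Finset.mem_insert_of_mem (hCB ▸ hxC)⟩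
        · exact ⟨C, Or.inr ⟨hCB, hC⟩, hxC⟩
    · rintro ⟨C, rfl | ⟨hCB, hC⟩, hxC⟩
      · rcases Finset.mem_insert.1 hxC with rfl | hx
        · exact Or.inl rfl
        · rcases Finset.mem_insert.1 hB with rfl | hB
          · simp at hx
          · exact Or.inr ((h2 x).2 ⟨B, hB, hx⟩)
      · exact Or.inr ((h2 x).2 ⟨C, hC, hxC⟩)

/-- The block containing `a` is unique in the result, so erasing `a` from it recovers `B`, and then
the other blocks are known too. -/
theorem addTo_injective {a : ℕ} {P Q : Finset (Finset ℕ)} {B C : Finset ℕ}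
    (hP : ∀ D ∈ P, a ∉ D) (hQ : ∀ D ∈ Q, a ∉ D) (hP0 : ∅ ∉ P) (hQ0 : ∅ ∉ Q)
    (hB : B ∈ insert ∅ P) (hC : C ∈ insert ∅ Q) (h : addTo a P B = addTo a Q C) :
    P = Q ∧ B = C := by
  have haB : a ∉ B := by
    rcases Finset.mem_insert.1 hB with rfl | hB
    · simp
    · exact hP B hB
  have haC : a ∉ C := by
    rcases Finset.mem_insert.1 hC with rfl | hC
    · simp
    · exact hQ C hC
  have hBC : B = C := by
    have h1 : insert a B ∈ addTo a Q C := h ▸ Finset.mem_insert_self _ _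
    rcases Finset.mem_insert.1 h1 with h1 | h1
    · rw [← Finset.erase_insert haB, h1, Finset.erase_insert haC]
    · exact absurd (Finset.mem_insert_self a B) (hQ _ (Finset.mem_of_mem_erase h1))
  subst hBC
  refine ⟨?_, rfl⟩
  have h2 : P.erase B = Q.erase B := by
    have e1 : insert a B ∉ P.erase B := fun h' =>
      hP _ (Finset.mem_of_mem_erase h') (Finset.mem_insert_self a B)
    have e2 : insert a B ∉ Q.erase B := fun h' =>
      hQ _ (Finset.mem_of_mem_erase h') (Finset.mem_insert_self a B)
    rw [← Finset.erase_insert e1, ← Finset.erase_insert e2]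
    exact congrArg (fun X => Finset.erase X (insert a B)) h
  rcases Finset.mem_insert.1 hB with rfl | hB
  · rwa [Finset.erase_eq_of_notMem hP0, Finset.erase_eq_of_notMem hQ0] at h2
  · rcases Finset.mem_insert.1 hC with rfl | hC
    · exact absurd hB hP0
    · rw [← Finset.insert_erase hB, h2, Finset.insert_erase hC]

theorem exists_addTo_eq {S : Finset ℕ} {a : ℕ} (ha : a ∉ S) {Q : Finset (Finset ℕ)}
    (hQ : Q ∈ partsOf (insert a S)) :
    ∃ P ∈ partsOf S, ∃ B ∈ insert ∅ P, addTo a P B = Q := by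
  rw [mem_partsOf] at hQ
  obtain ⟨h0, h1, h2⟩ := hQ
  obtain ⟨A, hA, haA⟩ := (h2 a).1 (Finset.mem_insert_self _ _)
  have hother : ∀ C ∈ Q, C ≠ A → a ∉ C := fun C hC hne haC => hne (h1 C hC A hA a haC haA)
  -- Delete `a` from its block `A`. If `A = {a}`, the remainder is `∅`, which the outer `erase`
  -- discards and which is also the code for a new block.
  refine ⟨(insert (A.erase a) (Q.erase A)).erase ∅, mem_partsOf.2 ⟨by simp, ?_, ?_⟩,
    A.erase a, ?_, ?_⟩
  · intro B hB C hC x hxB hxC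
    simp only [Finset.mem_erase, Finset.mem_insert] at hB hC
    rcases hB with ⟨_, rfl | ⟨hB, hB'⟩⟩ <;> rcases hC with ⟨_, rfl | ⟨hC, hC'⟩⟩
    · rfl
    · exact absurd (h1 C hC' A hA x hxC (Finset.mem_of_mem_erase hxB)) hC
    · exact absurd (h1 B hB' A hA x hxB (Finset.mem_of_mem_erase hxC)) hB
    · exact h1 B hB' C hC' x hxB hxC
  · intro x
    constructor
    · intro hx
      have hxa : x ≠ a := fun h => ha (h ▸ hx)
      obtain ⟨C, hC, hxC⟩ := (h2 x).1 (Finset.mem_insert_of_mem hx)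
      by_cases hCA : C = A
      · subst hCA
        have : x ∈ C.erase a := Finset.mem_erase.2 ⟨hxa, hxC⟩
        exact ⟨C.erase a, by simp [Finset.ne_empty_of_mem this], this⟩
      · exact ⟨C, by simp [Finset.ne_empty_of_mem hxC, hCA, hC], hxC⟩
    · rintro ⟨C, hC, hxC⟩
      have : x ≠ a ∧ ∃ C ∈ Q, x ∈ C := by
        simp only [Finset.mem_erase, Finset.mem_insert] at hC
        rcases hC with ⟨_, rfl | ⟨hC, hC'⟩⟩
        · exact ⟨(Finset.mem_erase.1 hxC).1, A, hA, (Finset.mem_erase.1 hxC).2⟩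
        · exact ⟨fun h => hother C hC' hC (h ▸ hxC), C, hC', hxC⟩
      exact (Finset.mem_insert.1 ((h2 x).2 this.2)).resolve_left this.1
  · by_cases h : A.erase a = ∅
    · simp [h]
    · simp [h]
  · have hmem : A.erase a ∉ Q.erase A := by
      intro h
      rw [Finset.mem_erase] at h
      rcases (A.erase a).eq_empty_or_nonempty with he | ⟨x, hx⟩
      · exact h0 (he ▸ h.2)
      · exact h.1 (h1 _ h.2 A hA x hx (Finset.mem_of_mem_erase hx))
    have hQ0 : ∅ ∉ Q.erase A := fun h => h0 (Finset.mem_of_mem_erase h)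
    rw [addTo, Finset.insert_erase haA, Finset.erase_right_comm, Finset.erase_insert hmem,
      Finset.erase_eq_of_notMem hQ0, Finset.insert_erase hA]

/-- Every partition of `insert a S` arises from exactly one partition of `S`, either by adding
the block `{a}` or by adding `a` to one of the blocks. -/
theorem sum_partsOf_insert {S : Finset ℕ} {a : ℕ} (ha : a ∉ S) {M : Type*} [AddCommMonoid M]
    (f : Finset (Finset ℕ) → M) :
    ∑ Q ∈ partsOf (insert a S), f Q =
      ∑ P ∈ partsOf S, (f (addTo a P ∅) + ∑ B ∈ P, f (addTo a P B)) := by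
  have hins : ∀ P ∈ partsOf S, f (addTo a P ∅) + ∑ B ∈ P, f (addTo a P B) =
      ∑ B ∈ insert ∅ P, f (addTo a P B) := fun P hP =>
    (Finset.sum_insert (f := fun B => f (addTo a P B)) (mem_partsOf.1 hP).1).symm
  rw [Finset.sum_congr rfl hins, Finset.sum_sigma']
  symm
  refine Finset.sum_nbij (fun x => addTo a x.1 x.2) ?_ ?_ ?_ (fun _ _ => rfl)
  · intro x hx
    rw [Finset.mem_sigma] at hx
    exact addTo_mem_partsOf ha hx.1 hx.2
  · rintro ⟨P, B⟩ hx ⟨Q, C⟩ hy h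
    rw [Finset.mem_coe, Finset.mem_sigma] at hx hy
    have hP := mem_partsOf.1 hx.1
    have hQ := mem_partsOf.1 hy.1
    obtain ⟨rfl, rfl⟩ := addTo_injective (fun D hD h => ha ((hP.2.2 a).2 ⟨D, hD, h⟩))
      (fun D hD h => ha ((hQ.2.2 a).2 ⟨D, hD, h⟩)) hP.1 hQ.1 hx.2 hy.2 h
    rfl
  · intro Q hQ
    obtain ⟨P, hP, B, hB, h⟩ := exists_addTo_eq ha hQ
    exact ⟨⟨P, B⟩, Finset.mem_coe.2 (Finset.mem_sigma.2 ⟨hP, hB⟩), h⟩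

theorem card_addTo_empty {a : ℕ} {P : Finset (Finset ℕ)} (hP : ∀ D ∈ P, a ∉ D) (h0 : ∅ ∉ P) :
    (addTo a P ∅).card = P.card + 1 := by
  rw [addTo, Finset.erase_eq_of_notMem h0, Finset.card_insert_of_notMem]
  exact fun h => hP _ h (Finset.mem_insert_self _ _)

theorem card_addTo_of_mem {a : ℕ} {P : Finset (Finset ℕ)} (hP : ∀ D ∈ P, a ∉ D)
    {B : Finset ℕ} (hB : B ∈ P) : (addTo a P B).card = P.card := by
  rw [addTo, Finset.card_insert_of_notMem, Finset.card_erase_add_one hB]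
  exact fun h => hP _ (Finset.mem_of_mem_erase h) (Finset.mem_insert_self _ _)

/-! ### Embracing pairs after insertion of a new maximum -/

open Classical in
/-- The number of embracing pairs in a set of blocks. -/
noncomputable def embPairs (P : Finset (Finset ℕ)) : ℝ :=
  ∑ B ∈ P, ∑ C ∈ P, if Embrace B C then 1 else 0

theorem emb_eq_embPairs {S : Finset ℕ} (π : Finpartition S) : (emb π : ℝ) = embPairs π.parts := by
  classical
  rw [emb, embPairs, Finset.card_filter, Finset.sum_product]
  push_cast
  refine Finset.sum_congr rfl fun B _ => Finset.sum_congr rfl fun C _ => ?_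
  congr

theorem not_embrace_self (B : Finset ℕ) : ¬ Embrace B B := by
  rintro ⟨h, h', h1, -⟩
  exact lt_irrefl _ h1

theorem not_embrace_of_mem_of_forall_lt {B C : Finset ℕ} {a : ℕ} (ha : a ∈ C)
    (hB : ∀ x ∈ B, x < a) : ¬ Embrace B C := by
  rintro ⟨h, h', -, -, h3⟩
  exact absurd (C.le_max' a ha) (not_le.2 (h3.trans (hB _ (B.max'_mem h))))

theorem not_embrace_singleton (C : Finset ℕ) (a : ℕ) : ¬ Embrace {a} C := by
  rintro ⟨h, h', h1, h2, h3⟩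
  have := (h1.trans_le h2).trans h3
  simp at this

/-- `B` has the smaller minimum. -/
def MinLT (B C : Finset ℕ) : Prop := ∃ x ∈ B, ∀ y ∈ C, x < y

/-- The element `a` settles the condition on maxima and cannot be the smaller minimum, so only the
comparison of minima survives. -/
theorem embrace_insert_iff {B C : Finset ℕ} {a : ℕ} (hC : C.Nonempty)
    (hCa : ∀ x ∈ C, x < a) : Embrace (insert a B) C ↔ MinLT B C := by
  constructor
  · rintro ⟨h, h', h1, -, -⟩
    refine ⟨(insert a B).min' h, ?_, fun y hy => h1.trans_le (C.min'_le y hy)⟩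
    refine (Finset.mem_insert.1 (Finset.min'_mem _ h)).resolve_left fun he => ?_
    have := hCa _ (C.min'_mem h')
    omega
  · rintro ⟨x, hx, hxC⟩
    refine ⟨Finset.insert_nonempty _ _, hC, ?_, Finset.min'_le_max' _ _, ?_⟩
    · exact (Finset.min'_le _ x (Finset.mem_insert_of_mem hx)).trans_lt (hxC _ (C.min'_mem hC))
    · exact (hCa _ (C.max'_mem hC)).trans_le (Finset.le_max' _ a (Finset.mem_insert_self _ _))

theorem minLT_iff {B C : Finset ℕ} (hB : B.Nonempty) (hC : C.Nonempty) :
    MinLT B C ↔ B.min' hB < C.min' hC := by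
  constructor
  · rintro ⟨x, hx, h⟩
    exact (B.min'_le x hx).trans_lt (h _ (C.min'_mem hC))
  · intro h
    exact ⟨_, B.min'_mem hB, fun y hy => h.trans_le (C.min'_le y hy)⟩

theorem minLT_or_minLT {B C : Finset ℕ} (hB : B.Nonempty) (hC : C.Nonempty)
    (hBC : Disjoint B C) : (MinLT B C ∧ ¬ MinLT C B) ∨ (MinLT C B ∧ ¬ MinLT B C) := by
  rw [minLT_iff hB hC, minLT_iff hC hB]
  have : B.min' hB ≠ C.min' hC := fun h =>
    Finset.disjoint_left.1 hBC (B.min'_mem hB) (h ▸ C.min'_mem hC)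
  omega

theorem not_minLT_self (B : Finset ℕ) : ¬ MinLT B B := by
  rintro ⟨x, hx, h⟩
  exact lt_irrefl _ (h x hx)

-- A block holding the overall maximum is never embraced, so it contributes only as an outer block.
open Classical in
theorem embPairs_insert {A : Finset ℕ} {P : Finset (Finset ℕ)} {a : ℕ} (hA : A ∉ P) (ha : a ∈ A)
    (hP : ∀ C ∈ P, ∀ x ∈ C, x < a) :
    embPairs (insert A P) = (∑ C ∈ P, if Embrace A C then 1 else 0) + embPairs P := by
  rw [embPairs, Finset.sum_insert hA, Finset.sum_insert hA, if_neg (not_embrace_self A), zero_add,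
    embPairs]
  congr 1
  refine Finset.sum_congr rfl fun C hC => ?_
  rw [Finset.sum_insert hA, if_neg (not_embrace_of_mem_of_forall_lt ha (hP C hC)), zero_add]

theorem embPairs_addTo_empty {P : Finset (Finset ℕ)} {a : ℕ} (h0 : ∅ ∉ P)
    (hP : ∀ C ∈ P, ∀ x ∈ C, x < a) : embPairs (addTo a P ∅) = embPairs P := by
  classical
  rw [addTo, Finset.erase_eq_of_notMem h0, embPairs_insert _ (Finset.mem_insert_self a ∅) hP]
  · rw [Finset.sum_eq_zero, zero_add]
    intro C _
    exact if_neg (not_embrace_singleton C a)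
  · exact fun h => lt_irrefl a (hP _ h a (Finset.mem_insert_self _ _))

open Classical in
theorem embPairs_addTo_of_mem {P : Finset (Finset ℕ)} {a : ℕ} (h0 : ∅ ∉ P)
    (hP : ∀ C ∈ P, ∀ x ∈ C, x < a) {B : Finset ℕ} (hB : B ∈ P) :
    embPairs (addTo a P B) = (∑ C ∈ P, if MinLT B C then 1 else 0) + embPairs (P.erase B) := by
  rw [addTo, embPairs_insert _ (Finset.mem_insert_self a B)
    fun C hC => hP C (Finset.mem_of_mem_erase hC)]
  · rw [← Finset.add_sum_erase P _ hB, if_neg (not_minLT_self B), zero_add]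
    congr 1
    refine Finset.sum_congr rfl fun C hC => ?_
    have hC := Finset.mem_of_mem_erase hC
    have hne : C.Nonempty := Finset.nonempty_iff_ne_empty.2 fun h => h0 (h ▸ hC)
    simp only [embrace_insert_iff hne (hP C hC)]
  · exact fun h => lt_irrefl a
      (hP _ (Finset.mem_of_mem_erase h) a (Finset.mem_insert_self _ _))

open Classical in
theorem embPairs_erase {P : Finset (Finset ℕ)} {B : Finset ℕ} (hB : B ∈ P) :
    embPairs (P.erase B) = embPairs P - (∑ C ∈ P, if Embrace B C then 1 else 0) -
      ∑ C ∈ P, if Embrace C B then 1 else 0 := by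
  have h (f : Finset ℕ → ℝ) : ∑ C ∈ P.erase B, f C = ∑ C ∈ P, f C - f B := by
    rw [← Finset.add_sum_erase P f hB]; ring
  simp only [embPairs, h, Finset.sum_sub_distrib, if_neg (not_embrace_self B)]
  ring

/-- An embracing pair consists of two distinct blocks, so it survives the removal of all but two
choices of `B`. -/
theorem sum_embPairs_erase (P : Finset (Finset ℕ)) :
    ∑ B ∈ P, embPairs (P.erase B) = (P.card - 2) * embPairs P := by
  classical
  rw [Finset.sum_congr rfl fun B hB => embPairs_erase hB, Finset.sum_sub_distrib,
    Finset.sum_sub_distrib, Finset.sum_const, nsmul_eq_mul]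
  have : ∑ B ∈ P, (∑ C ∈ P, if Embrace C B then (1 : ℝ) else 0) = embPairs P := Finset.sum_comm
  rw [this]
  change _ - embPairs P - _ = _
  ring

-- Distinct blocks are disjoint and nonempty, so exactly one of the two orders of each pair counts;
-- adding the sum to its transpose gives all ordered pairs.
open Classical in
theorem sum_minLT {P : Finset (Finset ℕ)} (h0 : ∅ ∉ P)
    (hP : ∀ B ∈ P, ∀ C ∈ P, ∀ x, x ∈ B → x ∈ C → B = C) :
    ∑ B ∈ P, (∑ C ∈ P, if MinLT B C then (1 : ℝ) else 0) = P.card * (P.card - 1) / 2 := by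
  have hsymm : ∑ B ∈ P, (∑ C ∈ P, if MinLT B C then (1 : ℝ) else 0) =
      ∑ B ∈ P, ∑ C ∈ P, if MinLT C B then (1 : ℝ) else 0 := Finset.sum_comm
  have hadd : ∑ B ∈ P, (∑ C ∈ P, if MinLT B C then (1 : ℝ) else 0) +
      ∑ B ∈ P, (∑ C ∈ P, if MinLT C B then (1 : ℝ) else 0) = P.card * (P.card - 1) := by
    rw [← Finset.sum_add_distrib]
    have hrow : ∀ B ∈ P, (∑ C ∈ P, if MinLT B C then (1 : ℝ) else 0) +
        (∑ C ∈ P, if MinLT C B then (1 : ℝ) else 0) = P.card - 1 := by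
      intro B hB
      rw [← Finset.sum_add_distrib, ← Finset.add_sum_erase P _ hB, if_neg (not_minLT_self B)]
      rw [Finset.sum_congr rfl (g := fun _ => (1 : ℝ))]
      · rw [Finset.sum_const, Finset.card_erase_of_mem hB, nsmul_eq_mul,
          Nat.cast_sub (Finset.card_pos.2 ⟨B, hB⟩)]
        simp
      · intro C hC
        rw [Finset.mem_erase] at hC
        have hd : Disjoint B C := Finset.disjoint_left.2 fun x hx hx' =>
          hC.1 (hP B hB C hC.2 x hx hx').symm
        have hBne : B.Nonempty := Finset.nonempty_iff_ne_empty.2 fun h => h0 (h ▸ hB)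
        have hCne : C.Nonempty := Finset.nonempty_iff_ne_empty.2 fun h => h0 (h ▸ hC.2)
        rcases minLT_or_minLT hBne hCne hd with ⟨h1, h2⟩ | ⟨h1, h2⟩ <;> simp [h1, h2]
    rw [Finset.sum_congr rfl hrow, Finset.sum_const, nsmul_eq_mul]
  linarith

theorem sum_embPairs_addTo {P : Finset (Finset ℕ)} {a : ℕ} (h0 : ∅ ∉ P)
    (hdisj : ∀ B ∈ P, ∀ C ∈ P, ∀ x, x ∈ B → x ∈ C → B = C) (hP : ∀ C ∈ P, ∀ x ∈ C, x < a) :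
    ∑ B ∈ P, embPairs (addTo a P B) =
      (P.card - 2) * embPairs P + P.card * (P.card - 1) / 2 := by
  classical
  rw [Finset.sum_congr rfl fun B hB => embPairs_addTo_of_mem h0 hP hB, Finset.sum_add_distrib,
    sum_minLT h0 hdisj, sum_embPairs_erase]
  ring

/-! ### Recurrences and closed forms by number of blocks -/

/-- The number of partitions of `S` into `k` blocks. -/
def partCount (S : Finset ℕ) (k : ℤ) : ℝ :=
  ∑ P ∈ partsOf S, if (P.card : ℤ) = k then 1 else 0

/-- The total number of embracings over the partitions of `S` into `k` blocks. -/
noncomputable def embCount (S : Finset ℕ) (k : ℤ) : ℝ :=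
  ∑ P ∈ partsOf S, if (P.card : ℤ) = k then embPairs P else 0

theorem partCount_insert {S : Finset ℕ} {a : ℕ} (ha : a ∉ S) (k : ℤ) :
    partCount (insert a S) k = k * partCount S k + partCount S (k - 1) := by
  rw [partCount, sum_partsOf_insert ha, partCount, partCount, Finset.mul_sum,
    ← Finset.sum_add_distrib]
  refine Finset.sum_congr rfl fun P hP => ?_
  obtain ⟨h0, -, h2⟩ := mem_partsOf.1 hP
  have haP : ∀ D ∈ P, a ∉ D := fun D hD h => ha ((h2 a).2 ⟨D, hD, h⟩)
  have hsum : ∑ B ∈ P, (if ((addTo a P B).card : ℤ) = k then (1 : ℝ) else 0) =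
      ∑ B ∈ P, (if (P.card : ℤ) = k then (1 : ℝ) else 0) :=
    Finset.sum_congr rfl fun B hB => by rw [card_addTo_of_mem haP hB]
  rw [hsum, Finset.sum_const, nsmul_eq_mul, card_addTo_empty haP h0, add_comm]
  congr 1
  · split_ifs with h
    · rw [← h]; push_cast; ring
    · simp
  · simp only [Nat.cast_add, Nat.cast_one, eq_sub_iff_add_eq]

theorem embCount_insert {S : Finset ℕ} {a : ℕ} (ha : ∀ x ∈ S, x < a) (k : ℤ) :
    embCount (insert a S) k =
      embCount S (k - 1) + (k - 2) * embCount S k + k * (k - 1) / 2 * partCount S k := by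
  have ha' : a ∉ S := fun h => lt_irrefl _ (ha a h)
  rw [embCount, sum_partsOf_insert ha', embCount, embCount, partCount, Finset.mul_sum,
    Finset.mul_sum, ← Finset.sum_add_distrib, ← Finset.sum_add_distrib]
  refine Finset.sum_congr rfl fun P hP => ?_
  obtain ⟨h0, h1, h2⟩ := mem_partsOf.1 hP
  have hlt : ∀ C ∈ P, ∀ x ∈ C, x < a := fun C hC x hx => ha x ((h2 x).2 ⟨C, hC, hx⟩)
  have haP : ∀ D ∈ P, a ∉ D := fun D hD h => ha' ((h2 a).2 ⟨D, hD, h⟩)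
  have hsum : ∑ B ∈ P, (if ((addTo a P B).card : ℤ) = k then embPairs (addTo a P B) else 0) =
      if (P.card : ℤ) = k then ∑ B ∈ P, embPairs (addTo a P B) else 0 := by
    rw [Finset.sum_congr rfl fun B hB => by rw [card_addTo_of_mem haP hB]]
    split_ifs <;> simp
  rw [hsum, sum_embPairs_addTo h0 h1 hlt, card_addTo_empty haP h0, embPairs_addTo_empty h0 hlt,
    add_assoc]
  congr 1
  · simp only [Nat.cast_add, Nat.cast_one, eq_sub_iff_add_eq]
  · split_ifs with h
    · rw [← h]; push_cast; ring
    · simp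

theorem stirlingS_succ (n : ℕ) (k : ℤ) :
    (stirlingS (n + 1) k : ℝ) = k * stirlingS n k + stirlingS n (k - 1) := by
  rcases k with k | k
  · rcases k with _ | k
    · simp [stirlingS]
    · have : (Int.ofNat (k + 1) - 1 : ℤ) = Int.ofNat k := by simp
      rw [this]
      simp only [stirlingS, Nat.stirlingSecond_succ_succ]
      push_cast
      simp
  · have : (Int.negSucc k - 1 : ℤ) = Int.negSucc (k + 1) := by omega
    rw [this]
    simp [stirlingS]

theorem stirlingS_zero (k : ℤ) : stirlingS 0 k = if k = 0 then 1 else 0 := by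
  rcases k with (_ | k) | k
  · simp [stirlingS]
  · have : (Int.ofNat (k + 1)) ≠ 0 := by
      simp only [Int.ofNat_eq_natCast]
      omega
    rw [if_neg this]
    rfl
  · simp [stirlingS]

theorem partsOf_empty : partsOf ∅ = {∅} := by
  ext P
  rw [mem_partsOf, Finset.mem_singleton]
  constructor
  · rintro ⟨h0, -, h2⟩
    refine Finset.eq_empty_of_forall_notMem fun B hB => ?_
    rcases B.eq_empty_or_nonempty with rfl | ⟨x, hx⟩
    · exact h0 hB
    · exact absurd ((h2 x).2 ⟨B, hB, hx⟩) (Finset.notMem_empty x)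
  · rintro rfl
    simp

theorem partCount_eq (S : Finset ℕ) (k : ℤ) : partCount S k = stirlingS S.card k := by
  induction S using Finset.induction_on generalizing k with
  | empty =>
    rw [partCount, partsOf_empty, Finset.sum_singleton]
    simp only [Finset.card_empty, stirlingS_zero]
    simp [eq_comm]
  | insert a S ha ih =>
    rw [partCount_insert ha, Finset.card_insert_of_notMem ha, stirlingS_succ, ih, ih]

/-- The right side satisfies the recurrence of `embCount_insert`. Integer `k` lets the shifts `k -
1`, `k - 2` run without boundary cases, and the truncated `S.card - 1` is harmless at `S = ∅`
because of the factor `S.card`. -/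
theorem embCount_eq (S : Finset ℕ) (k : ℤ) :
    embCount S k = k * (k - 1) / 4 * stirlingS S.card k - (k - 1) / 2 * stirlingS S.card (k - 1) +
      S.card / 2 * stirlingS (S.card - 1) (k - 2) := by
  induction S using Finset.induction_on_max generalizing k with
  | empty =>
    have : embPairs ∅ = 0 := by simp [embPairs]
    rw [embCount, partsOf_empty, Finset.sum_singleton, this]
    simp only [Finset.card_empty, stirlingS_zero]
    by_cases hk : k = 0
    · simp [hk]
    · by_cases hk1 : k = 1
      · simp [hk1]
      · have : k - 1 ≠ 0 := by omega
        simp [hk, this]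
  | insert a S ha ih =>
    have ha' : a ∉ S := fun h => lt_irrefl _ (ha a h)
    -- The Stirling recurrence one level down, multiplied by `S.card` so that it also holds for
    -- empty `S`.
    have hrec : (S.card : ℝ) * stirlingS S.card (k - 2) = S.card *
        ((k - 2) * stirlingS (S.card - 1) (k - 2) + stirlingS (S.card - 1) (k - 3)) := by
      rcases Nat.eq_zero_or_pos S.card with h | h
      · simp [h]
      · obtain ⟨m, hm⟩ := Nat.exists_eq_add_of_le' h
        rw [hm, stirlingS_succ, Nat.add_sub_cancel, show k - 2 - 1 = k - 3 by ring]
        push_cast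
        ring
    rw [embCount_insert ha, ih, ih, partCount_eq, Finset.card_insert_of_notMem ha',
      stirlingS_succ, stirlingS_succ, Nat.add_sub_cancel, show k - 1 - 1 = k - 2 by ring,
      show k - 1 - 2 = k - 3 by ring]
    push_cast
    linear_combination (-1 / 2 : ℝ) * hrec

/-! ### The mean for a given number of blocks -/

theorem sum_setPartitions (n : ℕ) (f : Finset (Finset ℕ) → ℝ) :
    ∑ π ∈ setPartitions n, f π.parts = ∑ P ∈ partsOf (Finset.Icc 1 n), f P :=
  sum_finpartition_eq_sum_partsOf f

theorem sum_emb_setPartitionsInto (n k : ℕ) :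
    ∑ π ∈ setPartitionsInto n k, (emb π : ℝ) = embCount (Finset.Icc 1 n) k := by
  rw [setPartitionsInto, Finset.sum_filter, embCount,
    ← sum_finpartition_eq_sum_partsOf (fun P => if (P.card : ℤ) = k then embPairs P else 0)]
  exact Finset.sum_congr rfl fun π _ => by simp only [emb_eq_embPairs, Nat.cast_inj]

theorem card_setPartitionsInto (n k : ℕ) :
    ((setPartitionsInto n k).card : ℝ) = stirlingS n k := by
  have h := partCount_eq (Finset.Icc 1 n) k
  rw [Nat.card_Icc, Nat.add_sub_cancel] at h
  rw [← h, setPartitionsInto, Finset.card_filter, partCount,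
    ← sum_finpartition_eq_sum_partsOf (fun P => if (P.card : ℤ) = k then (1 : ℝ) else 0)]
  push_cast
  exact Finset.sum_congr rfl fun π _ => by simp only [Nat.cast_inj]

theorem stirlingSecond_pow_le {n k : ℕ} (h : k ≤ n) : k ^ (n - k) ≤ Nat.stirlingSecond n k := by
  induction n, h using Nat.le_induction with
  | base => simp [Nat.stirlingSecond_self]
  | succ n h ih =>
    rcases k with _ | k
    · simp
    · rw [Nat.stirlingSecond_succ_succ, Nat.succ_sub h, pow_succ, mul_comm]
      exact (Nat.mul_le_mul_left _ ih).trans (Nat.le_add_right _ _)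

theorem stirlingS_pos {n k : ℕ} (hk : 1 ≤ k) (h : k ≤ n) : 0 < stirlingS n k :=
  (Nat.pow_pos hk).trans_le (stirlingSecond_pow_le h)

theorem meanEmbInto_eq (n k : ℕ) (hk : 1 ≤ k) (hkn : k ≤ n) :
    meanEmbInto n k = (1 / 2) * (k.choose 2 : ℝ)
        - (1 / 2) * ((k : ℝ) - 1) * ((stirlingS n ((k : ℤ) - 1) : ℝ) / (stirlingS n k : ℝ))
        + ((n : ℝ) / 2) *
          ((stirlingS (n - 1) ((k : ℤ) - 2) : ℝ) / (stirlingS n k : ℝ)) := by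
  have hpos : (stirlingS n k : ℝ) ≠ 0 := by exact_mod_cast (stirlingS_pos hk hkn).ne'
  rw [meanEmbInto, sum_emb_setPartitionsInto, card_setPartitionsInto, embCount_eq, Nat.card_Icc,
    Nat.add_sub_cancel, Nat.cast_choose_two]
  field_simp
  push_cast
  ring

/-- The extra summand `k ^ n` in the second bound absorbs the term `S_{n,k}` of the recurrence,
which lets the induction close. -/
theorem stirlingSecond_succ_add_pow_le (n k : ℕ) :
    Nat.stirlingSecond n k ≤ k ^ n ∧ Nat.stirlingSecond n (k + 1) + k ^ n ≤ (k + 1) ^ n := by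
  induction k generalizing n with
  | zero =>
    rcases n with _ | n
    · simp
    · simp [Nat.stirlingSecond_one_right]
  | succ k ih =>
    have h1 : ∀ n, Nat.stirlingSecond n (k + 1) ≤ (k + 1) ^ n := fun n =>
      (Nat.le_add_right _ _).trans (ih n).2
    refine ⟨h1 n, ?_⟩
    induction n with
    | zero => simp
    | succ n ihn =>
      rw [Nat.stirlingSecond_succ_succ]
      have := Nat.mul_le_mul_left (k + 1 + 1) ihn
      have := h1 n
      rw [pow_succ, pow_succ]
      nlinarith

theorem stirlingSecond_le_pow (n k : ℕ) : Nat.stirlingSecond n k ≤ k ^ n :=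
  (stirlingSecond_succ_add_pow_le n k).1

theorem tendsto_meanEmbInto (k : ℕ) (hk : 1 ≤ k) :
    Tendsto (fun n : ℕ => meanEmbInto n k - (1 / 2) * (k.choose 2 : ℝ)) atTop (𝓝 0) := by
  obtain ⟨j, rfl⟩ := Nat.exists_eq_add_of_le' hk
  set r : ℝ := j / (j + 1) with hr
  have hj : (0 : ℝ) < j + 1 := by positivity
  have hr0 : 0 ≤ r := by positivity
  have hr1 : r < 1 := (div_lt_one hj).2 (by linarith)
  -- With `k = j + 1`, both numerators are at most `j ^ n` and the denominator is at least `(j + 1)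
  -- ^ (n - (j + 1))`.
  have hlim : Tendsto (fun n : ℕ => (j + 1 : ℝ) ^ (j + 1) * (j * r ^ n + n * r ^ n)) atTop (𝓝 0) := by
    have h := ((tendsto_pow_atTop_nhds_zero_of_lt_one hr0 hr1).const_mul (j : ℝ)).add
      (tendsto_self_mul_const_pow_of_lt_one hr0 hr1)
    simpa using h.const_mul ((j + 1 : ℝ) ^ (j + 1))
  refine squeeze_zero_norm' ?_ hlim
  filter_upwards [eventually_ge_atTop (j + 1)] with n hn
  have hn1 : 1 ≤ n := by omega
  rw [meanEmbInto_eq n (j + 1) hk hn]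
  have hS : (j + 1 : ℝ) ^ n / (j + 1 : ℝ) ^ (j + 1) ≤ stirlingS n ((j + 1 : ℕ) : ℤ) := by
    rw [div_eq_mul_inv, ← pow_sub₀ _ hj.ne' hn]
    exact_mod_cast stirlingSecond_pow_le hn
  have hbound : ∀ x : ℝ, x ≤ (j : ℝ) ^ n → x / stirlingS n ((j + 1 : ℕ) : ℤ) ≤
      (j + 1 : ℝ) ^ (j + 1) * r ^ n := by
    intro x hx
    calc x / stirlingS n ((j + 1 : ℕ) : ℤ) ≤
          (j : ℝ) ^ n / ((j + 1 : ℝ) ^ n / (j + 1 : ℝ) ^ (j + 1)) := by gcongr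
      _ = _ := by rw [hr, div_pow]; field_simp
  have h1 : ((stirlingS n (((j + 1 : ℕ) : ℤ) - 1) : ℕ) : ℝ) ≤ (j : ℝ) ^ n := by
    rw [show ((j + 1 : ℕ) : ℤ) - 1 = (j : ℤ) by push_cast; ring]
    exact_mod_cast stirlingSecond_le_pow n j
  have h2 : ((stirlingS (n - 1) (((j + 1 : ℕ) : ℤ) - 2) : ℕ) : ℝ) ≤ (j : ℝ) ^ n := by
    rcases j with _ | i
    · simp [stirlingS]
    · rw [show ((i + 1 + 1 : ℕ) : ℤ) - 2 = (i : ℤ) by push_cast; ring]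
      have : Nat.stirlingSecond (n - 1) i ≤ (i + 1) ^ n :=
        (stirlingSecond_le_pow _ _).trans ((Nat.pow_le_pow_left (Nat.le_succ i) _).trans
          (Nat.pow_le_pow_right (Nat.succ_pos i) (Nat.sub_le n 1)))
      exact_mod_cast this
  have b1 := hbound _ h1
  have b2 := hbound _ h2
  have p1 : (0 : ℝ) ≤ (stirlingS n (((j + 1 : ℕ) : ℤ) - 1) : ℝ) / stirlingS n ((j + 1 : ℕ) : ℤ) := by
    positivity
  have p2 : (0 : ℝ) ≤ (stirlingS (n - 1) (((j + 1 : ℕ) : ℤ) - 2) : ℝ) /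
      stirlingS n ((j + 1 : ℕ) : ℤ) := by positivity
  set x := (stirlingS n (((j + 1 : ℕ) : ℤ) - 1) : ℝ) / stirlingS n ((j + 1 : ℕ) : ℤ)
  set y := (stirlingS (n - 1) (((j + 1 : ℕ) : ℤ) - 2) : ℝ) / stirlingS n ((j + 1 : ℕ) : ℤ)
  set c := (j + 1 : ℝ) ^ (j + 1) * r ^ n
  have e1 : (j : ℝ) * x ≤ j * c := by gcongr
  have e2 : (n : ℝ) * y ≤ n * c := by gcongr
  have q1 : 0 ≤ (j : ℝ) * x := by positivity
  have q2 : 0 ≤ (n : ℝ) * y := by positivity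
  have e3 : (j + 1 : ℝ) ^ (j + 1) * (j * r ^ n + n * r ^ n) = j * c + n * c := by ring
  rw [e3, Real.norm_eq_abs, abs_le]
  push_cast
  constructor <;> nlinarith

/-! ### Bell numbers as moments of Stirling rows -/

theorem stirlingSecond_succ_eq_sum (n k : ℕ) :
    Nat.stirlingSecond (n + 1) (k + 1) =
      ∑ i ∈ Finset.range (n + 1), n.choose i * Nat.stirlingSecond i k := by
  induction n generalizing k with
  | zero => simp [Nat.stirlingSecond_succ_succ]
  | succ n ih =>
    have hsplit : ∑ i ∈ Finset.range (n + 2), (n + 1).choose i * Nat.stirlingSecond i k =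
        ∑ i ∈ Finset.range (n + 1), n.choose i * Nat.stirlingSecond i k +
        ∑ i ∈ Finset.range (n + 1), n.choose i * Nat.stirlingSecond (i + 1) k := by
      have h : ∑ i ∈ Finset.range (n + 1), n.choose i * Nat.stirlingSecond i k =
          ∑ i ∈ Finset.range (n + 2), n.choose i * Nat.stirlingSecond i k := by
        rw [Finset.sum_range_succ _ (n + 1)]
        simp
      rw [h, Finset.sum_range_succ', Finset.sum_range_succ' _ (n + 1), add_right_comm,
        ← Finset.sum_add_distrib]
      congr 1
      · refine Finset.sum_congr rfl fun i _ => ?_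
        rw [Nat.choose_succ_succ]
        ring
      · simp
    rw [hsplit, Nat.stirlingSecond_succ_succ, ih]
    rcases k with _ | k
    · simp
    · rw [ih k, Finset.mul_sum, ← Finset.sum_add_distrib, ← Finset.sum_add_distrib]
      refine Finset.sum_congr rfl fun i _ => ?_
      rw [Nat.stirlingSecond_succ_succ]
      ring

theorem bell_succ_eq_sum_range (n : ℕ) :
    Nat.bell (n + 1) = ∑ i ∈ Finset.range (n + 1), n.choose i * Nat.bell i := by
  rw [Nat.bell_succ', ← Finset.Nat.sum_antidiagonal_swap,
    Finset.Nat.sum_antidiagonal_eq_sum_range_succ_mk]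
  refine Finset.sum_congr rfl fun i hi => ?_
  rw [Prod.fst_swap, Prod.snd_swap, Nat.choose_symm (Finset.mem_range_succ_iff.1 hi)]

theorem sum_stirlingSecond {n N : ℕ} (h : n < N) :
    ∑ k ∈ Finset.range N, Nat.stirlingSecond n k = Nat.bell n := by
  induction n using Nat.strong_induction_on generalizing N with
  | _ n ih =>
    obtain ⟨N, rfl⟩ := Nat.exists_eq_add_of_le' (Nat.one_le_of_lt h)
    rcases n with _ | n
    · rw [Finset.sum_range_succ']
      simp
    · rw [Finset.sum_range_succ', Nat.stirlingSecond_succ_zero, add_zero,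
        Finset.sum_congr rfl fun k _ => stirlingSecond_succ_eq_sum n k, Finset.sum_comm,
        bell_succ_eq_sum_range]
      refine Finset.sum_congr rfl fun i hi => ?_
      have hi := Finset.mem_range.1 hi
      rw [← Finset.mul_sum, ih i hi (by omega)]

/-- The Stirling recurrence moved onto the weight. Taking `g = 1` and then `g = k` expresses the
first two moments of a row by Bell numbers. -/
theorem sum_mul_stirlingSecond_succ {n N : ℕ} (h : n < N) (g : ℕ → ℝ) :
    ∑ k ∈ Finset.range (N + 1), g k * Nat.stirlingSecond (n + 1) k =
      ∑ k ∈ Finset.range N, (k * g k + g (k + 1)) * Nat.stirlingSecond n k := by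
  have hN : Nat.stirlingSecond n N = 0 := Nat.stirlingSecond_eq_zero_of_lt h
  have hshift : ∑ k ∈ Finset.range N, g (k + 1) * ((k + 1 : ℕ) * Nat.stirlingSecond n (k + 1)) =
      ∑ k ∈ Finset.range N, (k * g k) * (Nat.stirlingSecond n k : ℝ) := by
    have := Finset.sum_range_succ' (fun k => ((k : ℝ) * g k) * (Nat.stirlingSecond n k : ℝ)) N
    rw [Finset.sum_range_succ, hN] at this
    simp only [Nat.cast_zero, mul_zero, zero_mul, add_zero] at this
    rw [this]
    exact Finset.sum_congr rfl fun k _ => by ring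
  rw [Finset.sum_range_succ', Nat.stirlingSecond_succ_zero]
  simp only [Nat.stirlingSecond_succ_succ, Nat.cast_add, Nat.cast_mul, mul_add, add_mul,
    Finset.sum_add_distrib] at hshift ⊢
  rw [← hshift]
  simp

theorem sum_stirlingSecond_cast {n N : ℕ} (h : n < N) :
    ∑ k ∈ Finset.range N, (Nat.stirlingSecond n k : ℝ) = Nat.bell n := by
  exact_mod_cast sum_stirlingSecond h

theorem sum_id_mul_stirlingSecond {n N : ℕ} (h : n < N) :
    ∑ k ∈ Finset.range N, (k : ℝ) * Nat.stirlingSecond n k = Nat.bell (n + 1) - Nat.bell n := by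
  have h1 := sum_mul_stirlingSecond_succ h (fun _ => 1)
  simp only [one_mul, mul_one, add_mul, Finset.sum_add_distrib, sum_stirlingSecond_cast h,
    sum_stirlingSecond_cast (Nat.succ_lt_succ h)] at h1
  linarith

theorem sum_sq_mul_stirlingSecond {n N : ℕ} (h : n < N) :
    ∑ k ∈ Finset.range N, (k : ℝ) ^ 2 * Nat.stirlingSecond n k =
      Nat.bell (n + 2) - 2 * Nat.bell (n + 1) := by
  have h1 := sum_mul_stirlingSecond_succ h (fun k => (k : ℝ))
  rw [sum_id_mul_stirlingSecond (Nat.succ_lt_succ h)] at h1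
  simp only [← sq, Nat.cast_add, Nat.cast_one, add_mul, Finset.sum_add_distrib, one_mul,
    sum_stirlingSecond_cast h, sum_id_mul_stirlingSecond h] at h1
  linarith

theorem sum_partsOf_fiberwise {S : Finset ℕ} {N : ℕ} (h : S.card < N)
    (f : Finset (Finset ℕ) → ℝ) :
    ∑ P ∈ partsOf S, f P =
      ∑ k ∈ Finset.range N, ∑ P ∈ partsOf S, if (P.card : ℤ) = (k : ℕ) then f P else 0 := by
  rw [Finset.sum_comm]
  refine Finset.sum_congr rfl fun P hP => ?_
  obtain ⟨π, -, rfl⟩ := Finset.mem_image.1 hP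
  simp only [Nat.cast_inj, Finset.sum_ite_eq, Finset.mem_range]
  rw [if_pos (π.card_parts_le_card.trans_lt h)]

theorem card_setPartitions (n : ℕ) : ((setPartitions n).card : ℝ) = Nat.bell n := by
  have h1 := sum_setPartitions n (fun _ => 1)
  have h2 : (Finset.Icc 1 n).card < n + 1 := by simp
  rw [sum_partsOf_fiberwise h2] at h1
  have h3 : ∀ k : ℕ, (∑ P ∈ partsOf (Finset.Icc 1 n), if (P.card : ℤ) = (k : ℕ) then (1 : ℝ)
      else 0) = Nat.stirlingSecond n k := fun k => by
    have := partCount_eq (Finset.Icc 1 n) k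
    rwa [Nat.card_Icc, Nat.add_sub_cancel] at this
  simp only [h3, sum_stirlingSecond_cast (Nat.lt_succ_self n)] at h1
  rw [← h1]
  simp

theorem sum_emb_setPartitions (n : ℕ) (hn : 1 ≤ n) :
    ∑ π ∈ setPartitions n, (emb π : ℝ) = (1 / 4) * Nat.bell (n + 2) - (5 / 4) * Nat.bell (n + 1) +
      (3 / 4) * Nat.bell n + n / 2 * Nat.bell (n - 1) := by
  -- The range `n + 2` is long enough for the shifts by 1 and 2 to leave complete Stirling rows.
  have h2 : (Finset.Icc 1 n).card < n + 2 := by simp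
  have h3 : ∀ k : ℕ, (∑ P ∈ partsOf (Finset.Icc 1 n), if (P.card : ℤ) = (k : ℕ) then embPairs P
      else 0) = (k : ℝ) * (k - 1) / 4 * Nat.stirlingSecond n k -
        (k - 1) / 2 * stirlingS n ((k : ℤ) - 1) +
        n / 2 * stirlingS (n - 1) ((k : ℤ) - 2) := fun k => by
    have := embCount_eq (Finset.Icc 1 n) k
    rw [Nat.card_Icc, Nat.add_sub_cancel, Int.cast_natCast] at this
    exact this
  simp only [emb_eq_embPairs]
  rw [sum_setPartitions n embPairs, sum_partsOf_fiberwise h2]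
  simp only [h3, Finset.sum_add_distrib, Finset.sum_sub_distrib]
  have e1 : ∑ k ∈ Finset.range (n + 2), (k : ℝ) * (k - 1) / 4 * Nat.stirlingSecond n k =
      (Nat.bell (n + 2) - 3 * Nat.bell (n + 1) + Nat.bell n) / 4 := by
    have a := sum_id_mul_stirlingSecond (n := n) (N := n + 2) (by omega)
    have b := sum_sq_mul_stirlingSecond (n := n) (N := n + 2) (by omega)
    have : ∀ k ∈ Finset.range (n + 2), (k : ℝ) * (k - 1) / 4 * Nat.stirlingSecond n k =
        1 / 4 * ((k : ℝ) ^ 2 * Nat.stirlingSecond n k) - 1 / 4 * (k * Nat.stirlingSecond n k) :=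
      fun k _ => by ring
    rw [Finset.sum_congr rfl this, Finset.sum_sub_distrib, ← Finset.mul_sum, ← Finset.mul_sum, a, b]
    ring
  have e2 : ∑ k ∈ Finset.range (n + 2), ((k : ℝ) - 1) / 2 * stirlingS n ((k : ℤ) - 1) =
      (Nat.bell (n + 1) - Nat.bell n) / 2 := by
    rw [Finset.sum_range_succ', ← sum_id_mul_stirlingSecond (Nat.lt_succ_self n), Finset.sum_div]
    have : (stirlingS n (((0 : ℕ) : ℤ) - 1) : ℝ) = 0 := by simp [stirlingS]
    rw [this, mul_zero, add_zero]
    refine Finset.sum_congr rfl fun k _ => ?_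
    rw [show ((k + 1 : ℕ) : ℤ) - 1 = (k : ℤ) by push_cast; ring]
    simp only [stirlingS]
    push_cast
    ring
  have e3 : ∑ k ∈ Finset.range (n + 2), (n : ℝ) / 2 * stirlingS (n - 1) ((k : ℤ) - 2) =
      n / 2 * Nat.bell (n - 1) := by
    rw [← Finset.mul_sum, Finset.sum_range_succ', Finset.sum_range_succ',
      ← sum_stirlingSecond_cast (show n - 1 < n by omega)]
    have a1 : (stirlingS (n - 1) (((0 : ℕ) : ℤ) - 2) : ℝ) = 0 := by simp [stirlingS]
    have a2 : (stirlingS (n - 1) (((0 + 1 : ℕ) : ℤ) - 2) : ℝ) = 0 := by simp [stirlingS]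
    rw [a1, a2, add_zero, add_zero]
    congr 1
    refine Finset.sum_congr rfl fun k _ => ?_
    rw [show ((k + 1 + 1 : ℕ) : ℤ) - 2 = (k : ℤ) by push_cast; ring]
    rfl
  rw [e1, e2, e3]
  ring

theorem bell_pos (n : ℕ) : 0 < Nat.bell n := by
  rw [← sum_stirlingSecond (Nat.lt_succ_self n)]
  refine Finset.sum_pos' (fun _ _ => Nat.zero_le _) ⟨n, Finset.self_mem_range_succ n, ?_⟩
  rw [Nat.stirlingSecond_self]
  exact one_pos

theorem meanEmb_eq (n : ℕ) (hn : 1 ≤ n) :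
    meanEmb n = (1 / 4) * ((Nat.bell (n + 2) : ℝ) / (Nat.bell n : ℝ))
        - (5 / 4) * ((Nat.bell (n + 1) : ℝ) / (Nat.bell n : ℝ)) + 3 / 4
        + ((n : ℝ) / 2) * ((Nat.bell (n - 1) : ℝ) / (Nat.bell n : ℝ)) := by
  have h : (Nat.bell n : ℝ) ≠ 0 := by exact_mod_cast (bell_pos n).ne'
  rw [meanEmb, sum_emb_setPartitions n hn, card_setPartitions]
  field_simp

/-! ### Dobinski's formula and log-convexity -/

/-- The `n`-th moment of the weights `1 / k!`. -/
noncomputable def dobinski (n : ℕ) : ℝ := ∑' k : ℕ, (k : ℝ) ^ n / k.factorial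

theorem summable_pow_div_factorial (n : ℕ) :
    Summable fun k : ℕ => (k : ℝ) ^ n / k.factorial := by
  refine Summable.of_nonneg_of_le (fun k => by positivity) (fun k => ?_)
    ((Real.summable_pow_div_factorial (Real.exp 1)).mul_left (n.factorial : ℝ))
  have h : (k : ℝ) ^ n ≤ n.factorial * Real.exp k := by
    have := Real.pow_div_factorial_le_exp (k : ℝ) (Nat.cast_nonneg k) n
    rwa [div_le_iff₀' (by positivity)] at this
  rw [← Real.exp_nat_mul, mul_one, ← mul_div_assoc]
  gcongr

theorem succ_pow_div_factorial (n k : ℕ) :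
    ((k + 1 : ℕ) : ℝ) ^ (n + 1) / (k + 1).factorial = ((k : ℝ) + 1) ^ n / k.factorial := by
  rw [Nat.factorial_succ]
  push_cast
  field_simp
  ring

theorem dobinski_succ (n : ℕ) :
    dobinski (n + 1) = ∑ i ∈ Finset.range (n + 1), n.choose i * dobinski i := by
  have h0 : ∀ k : ℕ, ((k : ℝ) + 1) ^ n / k.factorial =
      ∑ i ∈ Finset.range (n + 1), (n.choose i : ℝ) * ((k : ℝ) ^ i / k.factorial) := by
    intro k
    rw [add_pow, Finset.sum_div]
    exact Finset.sum_congr rfl fun i _ => by rw [one_pow]; ring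
  rw [dobinski, (summable_pow_div_factorial (n + 1)).tsum_eq_zero_add]
  simp only [succ_pow_div_factorial, h0]
  rw [Summable.tsum_finsetSum fun i _ => (summable_pow_div_factorial i).mul_left _]
  simp [tsum_mul_left, dobinski]

/-- Both sides obey the same binomial recurrence and equal `e` at `n = 0`. -/
theorem dobinski_eq (n : ℕ) : dobinski n = Real.exp 1 * Nat.bell n := by
  induction n using Nat.strong_induction_on with
  | _ n ih =>
    rcases n with _ | n
    · rw [dobinski, Real.exp_eq_exp_ℝ, NormedSpace.exp_eq_tsum_div]
      simp
    · rw [dobinski_succ, bell_succ_eq_sum_range]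
      push_cast
      rw [Finset.mul_sum]
      refine Finset.sum_congr rfl fun i hi => ?_
      rw [ih i (Finset.mem_range.1 hi)]
      ring

theorem dobinski_pos (n : ℕ) : 0 < dobinski n := by
  rw [dobinski_eq]
  have := bell_pos n
  positivity

theorem dobinski_logConvex (n : ℕ) : dobinski (n + 1) ^ 2 ≤ dobinski n * dobinski (n + 2) := by
  -- Cauchy–Schwarz: this is the sum of `(k - t) ^ 2 * k ^ n / k!`.
  have key : ∀ t : ℝ, 0 ≤ dobinski (n + 2) - 2 * t * dobinski (n + 1) + t ^ 2 * dobinski n := by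
    intro t
    have h0 := summable_pow_div_factorial n
    have h1 := (summable_pow_div_factorial (n + 1)).mul_left (2 * t)
    have h2 := summable_pow_div_factorial (n + 2)
    rw [dobinski, dobinski, dobinski, ← tsum_mul_left, ← tsum_mul_left, ← h2.tsum_sub h1,
      ← (h2.sub h1).tsum_add (h0.mul_left _)]
    refine tsum_nonneg fun k => ?_
    have : (k : ℝ) ^ (n + 2) / k.factorial - 2 * t * ((k : ℝ) ^ (n + 1) / k.factorial) +
        t ^ 2 * ((k : ℝ) ^ n / k.factorial) = ((k : ℝ) - t) ^ 2 * (k : ℝ) ^ n / k.factorial := by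
      ring
    rw [this]
    positivity
  have hpos := dobinski_pos n
  have h := key (dobinski (n + 1) / dobinski n)
  field_simp at h
  nlinarith

theorem bell_logConvex (n : ℕ) :
    (Nat.bell (n + 1) : ℝ) ^ 2 ≤ Nat.bell n * Nat.bell (n + 2) := by
  have h := dobinski_logConvex n
  simp only [dobinski_eq] at h
  have : 0 < Real.exp 1 ^ 2 := by positivity
  refine le_of_mul_le_mul_left ?_ this
  linarith

/-! ### Implicit bounds for ratios of Bell numbers -/

/-- The ratio of consecutive Bell numbers. -/
noncomputable def bellRatio (n : ℕ) : ℝ := Nat.bell (n + 1) / Nat.bell n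

theorem bellRatio_pos (n : ℕ) : 0 < bellRatio n :=
  div_pos (Nat.cast_pos.2 (bell_pos _)) (Nat.cast_pos.2 (bell_pos _))

theorem bell_succ_eq_mul (n : ℕ) : (Nat.bell (n + 1) : ℝ) = bellRatio n * Nat.bell n := by
  have : (Nat.bell n : ℝ) ≠ 0 := by exact_mod_cast (bell_pos n).ne'
  rw [bellRatio, div_mul_cancel₀ _ this]

theorem bellRatio_monotone : Monotone bellRatio := by
  refine monotone_nat_of_le_succ fun n => ?_
  have h1 : (0 : ℝ) < Nat.bell n := Nat.cast_pos.2 (bell_pos _)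
  have h2 : (0 : ℝ) < Nat.bell (n + 1) := Nat.cast_pos.2 (bell_pos _)
  rw [bellRatio, bellRatio, div_le_div_iff₀ h1 h2]
  have := bell_logConvex n
  linarith

theorem one_le_bellRatio (n : ℕ) : 1 ≤ bellRatio n := by
  refine le_trans ?_ (bellRatio_monotone (Nat.zero_le n))
  simp [bellRatio]

theorem bell_le_pow_mul {n : ℕ} (j : ℕ) {i : ℕ} (h : i + j ≤ n) :
    (Nat.bell (i + j) : ℝ) ≤ bellRatio n ^ j * Nat.bell i := by
  induction j with
  | zero => simp
  | succ j ih =>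
    have hmono := bellRatio_monotone (show i + j ≤ n by omega)
    have hpos := bellRatio_pos n
    rw [← add_assoc, bell_succ_eq_mul, pow_succ']
    calc bellRatio (i + j) * Nat.bell (i + j)
        ≤ bellRatio n * (bellRatio n ^ j * Nat.bell i) := by gcongr; exact ih (by omega)
      _ = _ := by ring

/-- Monotone ratios give `B_i ≥ B_n / R_n ^ (n - i)`; insert this in the binomial recurrence for
`B_{n+1}`. -/
theorem one_add_inv_pow_le_bellRatio (n : ℕ) : (1 + (bellRatio n)⁻¹) ^ n ≤ bellRatio n := by
  have hR := bellRatio_pos n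
  have hB : (0 : ℝ) < Nat.bell n := Nat.cast_pos.2 (bell_pos n)
  rw [← mul_le_mul_iff_left₀ hB, ← bell_succ_eq_mul, bell_succ_eq_sum_range, add_pow,
    Finset.sum_mul]
  push_cast
  refine Finset.sum_le_sum fun i hi => ?_
  have hi := Finset.mem_range_succ_iff.1 hi
  have h := bell_le_pow_mul (n := n) (n - i) (i := i) (by omega)
  rw [Nat.add_sub_cancel' hi] at h
  rw [one_pow, one_mul, mul_comm _ (n.choose i : ℝ), mul_assoc]
  refine mul_le_mul_of_nonneg_left ?_ (Nat.cast_nonneg _)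
  rw [inv_pow, inv_mul_le_iff₀ (by positivity)]
  exact h

theorem le_bellRatio_of_le {n : ℕ} {x : ℝ} (hx : 0 < x) (h : x ≤ (1 + x⁻¹) ^ n) :
    x ≤ bellRatio n := by
  by_contra! hlt
  have hR := bellRatio_pos n
  have : (1 + x⁻¹) ^ n ≤ (1 + (bellRatio n)⁻¹) ^ n := by gcongr
  linarith [one_add_inv_pow_le_bellRatio n]

/-- The ratio is the mean of `k` under the weights `k ^ n / k!`. From `K` on these at least halve at
each step, so the mean excess over `K` is at most 1. -/
theorem bellRatio_le_of_le {n K : ℕ} (hK : 0 < K) (h : (1 + (K : ℝ)⁻¹) ^ n ≤ K / 2) :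
    bellRatio n ≤ K + 1 := by
  set w : ℕ → ℝ := fun k => (k : ℝ) ^ n / k.factorial with hw
  have hw0 : ∀ k, 0 ≤ w k := fun k => by positivity
  have hsw : Summable w := summable_pow_div_factorial n
  have hkw : ∀ k : ℕ, (k : ℝ) * w k = (k : ℝ) ^ (n + 1) / k.factorial := fun k => by
    simp only [hw]; ring
  have hskw : Summable fun k : ℕ => (k : ℝ) * w k := by
    simp only [hkw]; exact summable_pow_div_factorial (n + 1)
  have hsU : Summable fun k => ((k - K : ℕ) : ℝ) * w k :=
    hskw.of_nonneg_of_le (fun k => mul_nonneg (Nat.cast_nonneg _) (hw0 k)) fun k =>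
      mul_le_mul_of_nonneg_right (Nat.cast_le.2 (Nat.sub_le _ _)) (hw0 k)
  -- Truncated subtraction makes `k - K` the positive part. Summed over `k`, this bounds the total
  -- excess `U` by `(U + dobinski n) / 2`.
  have hstep : ∀ k : ℕ, ((k + 1 - K : ℕ) : ℝ) * w (k + 1) ≤
      1 / 2 * (((k - K : ℕ) : ℝ) * w k + w k) := by
    intro k
    rcases Nat.lt_or_ge k K with hk | hk
    · rw [show k + 1 - K = 0 by omega, Nat.cast_zero, zero_mul]
      have := hw0 k
      positivity
    · have h1 : w (k + 1) ≤ 1 / 2 * w k := by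
        have hk0 : (0 : ℝ) < k := by exact_mod_cast hK.trans_le hk
        have e1 : (k + 1) * w (k + 1) = (1 + (k : ℝ)⁻¹) ^ n * w k := by
          have := hkw (k + 1)
          rw [succ_pow_div_factorial] at this
          push_cast at this
          rw [this]
          simp only [hw]
          rw [show (k : ℝ) + 1 = (1 + (k : ℝ)⁻¹) * k by field_simp, mul_pow]
          ring
        have e2 : (1 + (k : ℝ)⁻¹) ^ n ≤ (k + 1) / 2 := by
          have hK' : (0 : ℝ) < K := by exact_mod_cast hK
          have hkK : (K : ℝ) ≤ k := by exact_mod_cast hk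
          calc (1 + (k : ℝ)⁻¹) ^ n ≤ (1 + (K : ℝ)⁻¹) ^ n := by gcongr
            _ ≤ K / 2 := h
            _ ≤ (k + 1) / 2 := by linarith
        have e3 : (k + 1) * w (k + 1) ≤ (k + 1) * (1 / 2 * w k) := by
          rw [e1]
          nlinarith [mul_le_mul_of_nonneg_right e2 (hw0 k)]
        exact le_of_mul_le_mul_left e3 (by positivity)
      rw [show k + 1 - K = k - K + 1 by omega]
      push_cast
      nlinarith [mul_le_mul_of_nonneg_left h1 (by positivity : (0 : ℝ) ≤ ((k - K : ℕ) : ℝ) + 1)]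
  have hU : ∑' k, ((k - K : ℕ) : ℝ) * w k ≤ dobinski n := by
    have e : ∑' k, ((k - K : ℕ) : ℝ) * w k ≤
        1 / 2 * (∑' k, ((k - K : ℕ) : ℝ) * w k + dobinski n) := by
      conv_lhs => rw [hsU.tsum_eq_zero_add]
      rw [Nat.zero_sub, Nat.cast_zero, zero_mul, zero_add, dobinski, ← hsU.tsum_add hsw,
        ← tsum_mul_left]
      exact ((summable_nat_add_iff 1).2 hsU).tsum_le_tsum hstep ((hsU.add hsw).mul_left _)
    linarith
  have hD : dobinski (n + 1) ≤ K * dobinski n + ∑' k, ((k - K : ℕ) : ℝ) * w k := by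
    rw [dobinski, dobinski, ← tsum_mul_left, ← (hsw.mul_left (K : ℝ)).tsum_add hsU]
    refine (summable_pow_div_factorial (n + 1)).tsum_le_tsum (fun k => ?_)
      ((hsw.mul_left (K : ℝ)).add hsU)
    rw [← hkw, ← add_mul]
    refine mul_le_mul_of_nonneg_right ?_ (hw0 k)
    have : k ≤ K + (k - K) := by omega
    exact_mod_cast this
  have hfin : dobinski (n + 1) ≤ (K + 1) * dobinski n := by linarith
  rw [dobinski_eq, dobinski_eq, mul_left_comm] at hfin
  have hB : (0 : ℝ) < Nat.bell n := Nat.cast_pos.2 (bell_pos n)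
  rw [bellRatio, div_le_iff₀ hB]
  exact le_of_mul_le_mul_left hfin (Real.exp_pos 1)

/-! ### Second-order asymptotics of the ratios -/

theorem tendsto_log_natCast : Tendsto (fun n : ℕ => Real.log n) atTop atTop :=
  Real.tendsto_log_atTop.comp tendsto_natCast_atTop_atTop

theorem tendsto_log_log_natCast : Tendsto (fun n : ℕ => Real.log (Real.log n)) atTop atTop :=
  Real.tendsto_log_atTop.comp tendsto_log_natCast

theorem tendsto_log_log_div_log :
    Tendsto (fun n : ℕ => Real.log (Real.log n) / Real.log n) atTop (𝓝 0) :=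
  (Real.isLittleO_log_id_atTop.tendsto_div_nhds_zero).comp tendsto_log_natCast

theorem tendsto_log_sq_div :
    Tendsto (fun n : ℕ => Real.log n ^ 2 / (n * (Real.log (Real.log n) / Real.log n)))
      atTop (𝓝 0) := by
  have h1 : Tendsto (fun n : ℕ => Real.log n ^ 3 / n) atTop (𝓝 0) := by
    have h : (fun x : ℝ => Real.log x ^ 3) =o[atTop] (fun x => x) := Real.isLittleO_pow_log_id_atTop
    exact h.tendsto_div_nhds_zero.comp tendsto_natCast_atTop_atTop
  have h2 := h1.mul tendsto_log_log_natCast.inv_tendsto_atTop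
  rw [mul_zero] at h2
  refine h2.congr fun n => ?_
  simp only [Pi.inv_apply]
  rw [div_eq_mul_inv, div_eq_mul_inv, div_eq_mul_inv, mul_inv, mul_inv, inv_inv]
  ring

/-- Size comparisons between `n`, `log n` and `log (log n) / log n` for large `n`. -/
theorem eventually_log_bounds {c : ℝ} (hc : 0 < c) :
    ∀ᶠ n : ℕ in atTop, 1 ≤ Real.log n ∧ 0 < Real.log (Real.log n) / Real.log n ∧
      Real.log (Real.log n) / Real.log n ≤ c ∧
      1 / Real.log n ≤ c * (Real.log (Real.log n) / Real.log n) ∧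
      Real.log n / n ≤ c * (Real.log (Real.log n) / Real.log n) := by
  filter_upwards [tendsto_log_natCast.eventually_ge_atTop 1,
    tendsto_log_log_natCast.eventually_ge_atTop (max 1 (1 / c)),
    tendsto_log_log_div_log.eventually_le_const hc,
    tendsto_log_sq_div.eventually_le_const hc, eventually_gt_atTop 0] with n h1 h2 h3 h4 h5
  have hl : 0 < Real.log (Real.log n) := one_pos.trans_le ((le_max_left _ _).trans h2)
  have hl2 : 1 / c ≤ Real.log (Real.log n) := (le_max_right _ _).trans h2
  have hL : 0 < Real.log n := one_pos.trans_le h1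
  have hn : (0 : ℝ) < n := Nat.cast_pos.2 h5
  have hr : 0 < Real.log (Real.log n) / Real.log n := div_pos hl hL
  refine ⟨h1, hr, h3, ?_, ?_⟩
  · rw [← mul_div_assoc]
    gcongr
    rwa [div_le_iff₀' hc] at hl2
  · rw [div_le_iff₀ (by positivity)] at h4
    rw [div_le_iff₀ hn]
    nlinarith

theorem eventually_le_bellRatio {δ : ℝ} (hδ : 0 < δ) (hδ1 : δ ≤ 1) :
    ∀ᶠ n : ℕ in atTop, (n / Real.log n) * (1 + (1 - δ) * (Real.log (Real.log n) / Real.log n)) ≤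
      bellRatio n := by
  filter_upwards [eventually_log_bounds (show 0 < δ / 4 by positivity),
    eventually_gt_atTop 0] with n ⟨hL1, hr, hr1, hu, hv⟩ hn
  have hn : (0 : ℝ) < n := Nat.cast_pos.2 hn
  set L := Real.log n with hL
  have hL0 : 0 < L := one_pos.trans_le hL1
  set r := Real.log L / L with hr'
  have hl : Real.log L = r * L := by rw [hr']; field_simp
  set x := n / L * (1 + (1 - δ) * r) with hx
  have hs : 0 ≤ (1 - δ) * r := mul_nonneg (by linarith) hr.le
  have hx0 : 0 < x := by positivity
  have hlogx : Real.log x ≤ L - r * L + 1 := by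
    rw [hx, Real.log_mul (by positivity) (by positivity), Real.log_div hn.ne' hL0.ne', ← hL, hl]
    have := Real.log_le_sub_one_of_pos (show 0 < 1 + (1 - δ) * r by positivity)
    nlinarith
  -- This suffices because `log (1 + 1/x) ≥ 1 / (x + 1)`. The two stray `+ 1`s cost at most `δ / 4 *
  -- r` each, out of the available `δ * r`.
  have hprod : (x + 1) * Real.log x ≤ n := by
    have e1 : x + 1 = n / L * (1 + (1 - δ) * r + L / n) := by rw [hx]; field_simp
    have e2 : L - r * L + 1 = L * (1 - r + 1 / L) := by field_simp
    have hu0 : 0 < 1 / L := by positivity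
    have hv0 : 0 < L / n := by positivity
    have hpos : 0 ≤ 1 - r + 1 / L := by linarith
    have key : (1 + (1 - δ) * r + L / n) * (1 - r + 1 / L) ≤ 1 := by
      calc (1 + (1 - δ) * r + L / n) * (1 - r + 1 / L)
          ≤ (1 + (1 - δ) * r + δ / 4 * r) * (1 - r + δ / 4 * r) := by gcongr
        _ = 1 - δ / 2 * r - (1 - 3 * δ / 4) * (1 - δ / 4) * r ^ 2 := by ring
        _ ≤ 1 := by
          have : 0 ≤ (1 - 3 * δ / 4) * (1 - δ / 4) * r ^ 2 :=
            mul_nonneg (mul_nonneg (by linarith) (by linarith)) (sq_nonneg r)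
          nlinarith
    calc (x + 1) * Real.log x ≤ (x + 1) * (L - r * L + 1) := by gcongr
      _ = n * ((1 + (1 - δ) * r + L / n) * (1 - r + 1 / L)) := by
        rw [e2, e1]; field_simp
      _ ≤ n * 1 := by gcongr
      _ = n := mul_one _
  refine le_bellRatio_of_le hx0 ?_
  rw [← Real.log_le_log_iff hx0 (by positivity), Real.log_pow]
  have h1 : 1 / (x + 1) ≤ Real.log (1 + x⁻¹) := by
    have := Real.one_sub_inv_le_log_of_pos (show 0 < 1 + x⁻¹ by positivity)
    refine le_trans (le_of_eq ?_) this
    field_simp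
    ring
  calc Real.log x ≤ n * (1 / (x + 1)) := by
        rw [mul_one_div, le_div_iff₀ (by positivity)]; linarith
    _ ≤ _ := by gcongr

/-- Bounding the ratio at `n + 1` in terms of `n` lets `R_n` and `R_{n+1}` share the normalisation
`n / log n`. -/
theorem eventually_bellRatio_succ_le {δ : ℝ} (hδ : 0 < δ) (hδ1 : δ ≤ 1) :
    ∀ᶠ n : ℕ in atTop, bellRatio (n + 1) ≤
      (n / Real.log n) * (1 + (1 + δ) * (Real.log (Real.log n) / Real.log n)) := by
  filter_upwards [eventually_log_bounds (show 0 < δ / 8 by positivity),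
    eventually_gt_atTop 0] with n ⟨hL1, hr, hr1, hu, hv⟩ hn
  have hn1 : (1 : ℝ) ≤ n := Nat.one_le_cast.2 hn
  have hn : (0 : ℝ) < n := Nat.cast_pos.2 hn
  set L := Real.log n with hL
  have hL0 : 0 < L := one_pos.trans_le hL1
  set r := Real.log L / L with hr'
  have hl : Real.log L = r * L := by rw [hr']; field_simp
  set y := n / L * (1 + (1 + δ) * r) with hy
  set z := n / L * (1 + (1 + δ / 2) * r) with hz
  have hm : 0 < n / L := by positivity
  have hzy : z + 2 ≤ y := by
    have h : 1 ≤ n / L * (δ / 8 * r) := by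
      calc (1 : ℝ) = n / L * (L / n) := by field_simp
        _ ≤ _ := by gcongr
    rw [hy, hz]
    nlinarith
  have hz0 : 0 < z := by positivity
  -- The gap `z + 2 ≤ y` leaves room for an integer `K ≥ z` with `K + 1 ≤ y`.
  have hfloor : 1 ≤ ⌊y⌋₊ := Nat.le_floor (by push_cast; linarith)
  set K := ⌊y⌋₊ - 1 with hK
  have hKcast : (K : ℝ) = ⌊y⌋₊ - 1 := by rw [hK, Nat.cast_sub hfloor, Nat.cast_one]
  have hKy : (K : ℝ) + 1 ≤ y := by
    rw [hKcast, sub_add_cancel]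
    exact Nat.floor_le (by linarith)
  have hzK : z ≤ K := by
    have := Nat.lt_floor_add_one y
    linarith
  have hK0 : (0 : ℝ) < K := hz0.trans_le hzK
  refine (bellRatio_le_of_le (Nat.cast_pos.1 hK0) ?_).trans hKy
  have hlogK : L - r * L - 1 ≤ Real.log (K / 2) := by
    have h1 : n / L ≤ K := by
      refine le_trans ?_ hzK
      rw [hz]
      exact le_mul_of_one_le_right hm.le (by linarith [show 0 < (1 + δ / 2) * r by positivity])
    have h2 : Real.log (n / L) ≤ Real.log K := Real.log_le_log hm h1
    rw [Real.log_div hn.ne' hL0.ne', ← hL, hl] at h2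
    rw [Real.log_div hK0.ne' two_ne_zero]
    linarith [Real.log_two_lt_d9]
  have hmain : (n : ℝ) + 1 ≤ K * Real.log (K / 2) := by
    have e2 : L - r * L - 1 = L * (1 - r - 1 / L) := by field_simp
    have hpos : 0 ≤ 1 - r - δ / 8 * r := by nlinarith
    -- The linear gain is `3 * δ / 8`; the quadratic term costs at most `δ / 4` as `r ≤ δ / 8`, and
    -- the remaining `δ / 8` pays for the `+ 1` in `n + 1`.
    have key : 1 + δ / 8 * r ≤ (1 + (1 + δ / 2) * r) * (1 - r - δ / 8 * r) := by
      have h2 : (1 + δ / 2) * (1 + δ / 8) ≤ 2 := by nlinarith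
      have h3 : (1 + δ / 2) * (1 + δ / 8) * r ≤ 2 * (δ / 8) := by gcongr
      have : (1 + (1 + δ / 2) * r) * (1 - r - δ / 8 * r) =
          1 + r * (3 * δ / 8 - (1 + δ / 2) * (1 + δ / 8) * r) := by ring
      rw [this]
      nlinarith
    have hinv : 1 / (n : ℝ) ≤ δ / 8 * r := le_trans (by gcongr) hv
    have hu' : 1 - r - δ / 8 * r ≤ 1 - r - 1 / L := by linarith
    have hlog0 : 0 ≤ L - r * L - 1 := by
      rw [e2]; exact mul_nonneg hL0.le (hpos.trans hu')
    calc (n : ℝ) + 1 = n * (1 + 1 / n) := by field_simp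
      _ ≤ n * ((1 + (1 + δ / 2) * r) * (1 - r - δ / 8 * r)) := by
        gcongr; linarith
      _ ≤ n * ((1 + (1 + δ / 2) * r) * (1 - r - 1 / L)) := by gcongr
      _ = z * (L - r * L - 1) := by rw [e2, hz]; field_simp
      _ ≤ K * Real.log (K / 2) := by gcongr
  calc (1 + (K : ℝ)⁻¹) ^ (n + 1) ≤ Real.exp ((K : ℝ)⁻¹) ^ (n + 1) := by
        gcongr
        rw [add_comm]
        exact Real.add_one_le_exp _
    _ = Real.exp ((n + 1) / K) := by
        rw [← Real.exp_nat_mul]; push_cast; rw [div_eq_mul_inv]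
    _ ≤ K / 2 := by
        rw [← Real.le_log_iff_exp_le (by positivity), div_le_iff₀' hK0]
        exact hmain

/-- The second order term of a sequence squeezed between consecutive ratios of Bell numbers. -/
theorem tendsto_second_order {f : ℕ → ℝ} (h1 : ∀ n, bellRatio n ≤ f n)
    (h2 : ∀ n, f n ≤ bellRatio (n + 1)) :
    Tendsto (fun n : ℕ => (f n / (n / Real.log n) - 1) / (Real.log (Real.log n) / Real.log n))
      atTop (𝓝 1) := by
  rw [Metric.tendsto_atTop']
  intro e he
  set δ := min (e / 2) 1 with hδ
  have hδ0 : 0 < δ := by positivity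
  have hδ1 : δ ≤ 1 := min_le_right _ _
  have hδe : δ < e := (min_le_left _ _).trans_lt (by linarith)
  obtain ⟨N, hN⟩ := eventually_atTop.1 ((eventually_le_bellRatio hδ0 hδ1).and
    ((eventually_bellRatio_succ_le hδ0 hδ1).and
      ((eventually_log_bounds one_pos).and (eventually_gt_atTop 0))))
  refine ⟨N, fun n hn => ?_⟩
  obtain ⟨hlo, hup, ⟨hL, hr, -⟩, hn0⟩ := hN n hn.le
  have hn0 : (0 : ℝ) < n := Nat.cast_pos.2 hn0
  have hm : 0 < n / Real.log n := div_pos hn0 (one_pos.trans_le hL)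
  have hlo' := hlo.trans (h1 n)
  have hup' := (h2 n).trans hup
  rw [← le_div_iff₀' hm] at hlo'
  rw [← div_le_iff₀' hm] at hup'
  rw [Real.dist_eq]
  refine lt_of_le_of_lt (abs_le.2 ⟨?_, ?_⟩) hδe
  · rw [le_sub_iff_add_le, le_div_iff₀ hr]
    linarith
  · rw [sub_le_iff_le_add, div_le_iff₀ hr]
    linarith

/-! ### Asymptotics of the mean -/

theorem meanEmb_eq_bellRatio (n : ℕ) (hn : 1 ≤ n) :
    meanEmb n = (1 / 4) * (bellRatio n * bellRatio (n + 1)) - (5 / 4) * bellRatio n + 3 / 4 +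
      (n / 2) * (bellRatio (n - 1))⁻¹ := by
  have h1 : (Nat.bell n : ℝ) ≠ 0 := by exact_mod_cast (bell_pos n).ne'
  have h2 : (Nat.bell (n + 1) : ℝ) ≠ 0 := by exact_mod_cast (bell_pos (n + 1)).ne'
  rw [meanEmb_eq n hn, bellRatio, bellRatio, bellRatio, Nat.sub_add_cancel hn, inv_div]
  field_simp

theorem meanEmb_asymptotics : ∃ ε : ℕ → ℝ, Tendsto ε atTop (𝓝 0) ∧
      ∀ᶠ n : ℕ in atTop,
        meanEmb n = (1 / 4) * ((n : ℝ) / Real.log n) ^ 2 *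
          (1 + 2 * (Real.log (Real.log n) / Real.log n) * (1 + ε n)) := by
  set r : ℕ → ℝ := fun n => Real.log (Real.log n) / Real.log n with hr
  set m : ℕ → ℝ := fun n => n / Real.log n with hm
  set a : ℕ → ℝ := fun n => (bellRatio n / m n - 1) / r n with ha
  set b : ℕ → ℝ := fun n => (bellRatio (n + 1) / m n - 1) / r n with hb
  set s : ℕ → ℝ := fun n => Real.log n ^ 2 / (n * r n) with hs
  have hat : Tendsto a atTop (𝓝 1) :=
    tendsto_second_order (fun n => le_rfl) fun n => bellRatio_monotone n.le_succ
  have hbt : Tendsto b atTop (𝓝 1) :=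
    tendsto_second_order (fun n => bellRatio_monotone n.le_succ) fun n => le_rfl
  have hrt : Tendsto r atTop (𝓝 0) := tendsto_log_log_div_log
  have hst : Tendsto s atTop (𝓝 0) := tendsto_log_sq_div
  have hLt : Tendsto (fun n : ℕ => (Real.log n)⁻¹) atTop (𝓝 0) :=
    tendsto_log_natCast.inv_tendsto_atTop
  have hnt : Tendsto (fun n : ℕ => (n : ℝ)⁻¹) atTop (𝓝 0) :=
    tendsto_natCast_atTop_atTop.inv_tendsto_atTop
  -- For the term `n / (2 R_{n-1})` the crude bound `R ≥ 1` is enough.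
  have hct : Tendsto (fun n => s n * (bellRatio (n - 1))⁻¹) atTop (𝓝 0) := by
    refine squeeze_zero_norm (fun n => ?_) (tendsto_norm_zero.comp hst)
    rw [norm_mul]
    refine mul_le_of_le_one_right (norm_nonneg _) ?_
    rw [norm_inv, Real.norm_of_nonneg (bellRatio_pos _).le]
    exact inv_le_one_of_one_le₀ (one_le_bellRatio _)
  -- Solve the required identity for the error, dividing by `m ^ 2 * r / 2`; here `s = n / (m ^ 2 *
  -- r)`. Since `a` and `b` tend to 1, every part vanishes.
  refine ⟨fun n => (a n + b n) / 2 - 1 + r n * a n * b n / 2 -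
      5 / 2 * (s n * (Real.log n)⁻¹ * (1 + r n * a n)) + 3 / 2 * (s n * (n : ℝ)⁻¹) +
      s n * (bellRatio (n - 1))⁻¹, ?_, ?_⟩
  · have h := (((((hat.add hbt).div_const 2).sub_const 1).add
      (((hrt.mul hat).mul hbt).div_const 2)).sub
      (((hst.mul hLt).mul ((hrt.mul hat).const_add 1)).const_mul (5 / 2))).add
      ((hst.mul hnt).const_mul (3 / 2)) |>.add hct
    convert h using 2
    norm_num
  · filter_upwards [eventually_log_bounds one_pos, eventually_ge_atTop 1] with n ⟨hL, hr0, _⟩ hn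
    have hn0 : (0 : ℝ) < n := Nat.cast_pos.2 hn
    have hL0 : 0 < Real.log n := one_pos.trans_le hL
    have hm0 : m n ≠ 0 := (div_pos hn0 hL0).ne'
    have hrn : r n ≠ 0 := hr0.ne'
    have eA : bellRatio n = m n * (1 + r n * a n) := by
      simp only [ha]; field_simp; ring
    have eB : bellRatio (n + 1) = m n * (1 + r n * b n) := by
      simp only [hb]; field_simp; ring
    have eS : s n * r n * m n ^ 2 = n := by
      simp only [hs, hm]; field_simp
    have eL : s n * (Real.log n)⁻¹ * r n * m n = 1 := by
      simp only [hs, hm]; field_simp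
    have eN : s n * (n : ℝ)⁻¹ * r n * m n ^ 2 = 1 := by
      rw [mul_right_comm (s n), mul_right_comm, eS]; field_simp
    rw [meanEmb_eq_bellRatio n hn, eA, eB]
    change _ = 1 / 4 * m n ^ 2 * (1 + 2 * r n * _)
    linear_combination (5 / 4 * m n * (1 + r n * a n)) * eL - 3 / 4 * eN -
      1 / 2 * (bellRatio (n - 1))⁻¹ * eS

theorem theorem2p6 :
    -- exact mean over all partitions of `[n]`
    (∀ n : ℕ, 1 ≤ n →
      meanEmb n = (1 / 4) * ((Nat.bell (n + 2) : ℝ) / (Nat.bell n : ℝ))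
        - (5 / 4) * ((Nat.bell (n + 1) : ℝ) / (Nat.bell n : ℝ)) + 3 / 4
        + ((n : ℝ) / 2) * ((Nat.bell (n - 1) : ℝ) / (Nat.bell n : ℝ))) ∧
    -- its asymptotics
    (∃ ε : ℕ → ℝ, Tendsto ε atTop (𝓝 0) ∧
      ∀ᶠ n : ℕ in atTop,
        meanEmb n = (1 / 4) * ((n : ℝ) / Real.log n) ^ 2 *
          (1 + 2 * (Real.log (Real.log n) / Real.log n) * (1 + ε n))) ∧
    -- exact mean over the partitions of `[n]` into `k` blocks
    (∀ n k : ℕ, 1 ≤ k → k ≤ n →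
      meanEmbInto n k = (1 / 2) * (k.choose 2 : ℝ)
        - (1 / 2) * ((k : ℝ) - 1) * ((stirlingS n ((k : ℤ) - 1) : ℝ) / (stirlingS n k : ℝ))
        + ((n : ℝ) / 2) *
          ((stirlingS (n - 1) ((k : ℤ) - 2) : ℝ) / (stirlingS n k : ℝ))) ∧
    -- its asymptotics, for a fixed number of blocks
    (∀ k : ℕ, 1 ≤ k →
      Tendsto (fun n : ℕ => meanEmbInto n k - (1 / 2) * (k.choose 2 : ℝ)) atTop (𝓝 0)) :=
  ⟨meanEmb_eq, meanEmb_asymptotics, meanEmbInto_eq, tendsto_meanEmbInto⟩
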